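/- Let $k$ be a (commutative) field, $G$ a group, and $\mathcal{L}$ a local system of $G$, that is, an upwardly directed collection of subgroups of $G$ whose union is $G$. $G$-modules are $k$-linear representations of $G$; for a $G$-module $V$, $V^\vee$ denotes its dual with the contragredient action, $[V,G]$ the submodule spanned by all $gv-v$ ($g\in G$, $v\in V$), and $C_V(G)$ the submodule of $G$-fixed vectors. Let $0\to V\xrightarrow{\iota} W\xrightarrow{\pi} Q\to 0$ be an exact sequence of $G$-modules, where $V$ is arbitrary (for example, finitary) and $G$ acts trivially on $Q$. Suppose that the extension is locally split: for every $L\in\mathcal{L}$, $\pi$ has an $L$-equivariant $k$-linear section. Then: (1) The extension is represented in the double dual: there is a $G$-homomorphism $\varphi: W\to V^{\vee\vee}$ that extends the canonical embedding of $V$ in its double dual, i.e. $\varphi(\iota(v))(\lambda)=\lambda(v)$ for all $v\in V$, $\lambda\in V^\vee$. (2) There is a canonical injection $W/C_W(G)\hookrightarrow [V^\vee,G]^\vee$: there is a unique injective $G$-homomorphism $\psi: W/C_W(G)\to [V^\vee,G]^\vee$ such that, for every $\varphi$ as in (1) and every $w\in W$, $\psi(w+C_W(G))$ is the restriction of $\varphi(w)$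 to $[V^\vee,G]$. -/

import Mathlib

namespace LocalCohomology

/-- A local system of a group: an upwardly directed collection of subgroups whose union is the
whole group. -/
structure IsLocalSystem {G : Type*} [Group G] (𝓛 : Set (Subgroup G)) : Prop where
  directed : DirectedOn (· ≤ ·) 𝓛
  exists_mem : ∀ g : G, ∃ L ∈ 𝓛, g ∈ L

section

variable {k G V W Q : Type*} [Field k] [Group G] [AddCommGroup V] [Module k V]
  [AddCommGroup W] [Module k W] [AddCommGroup Q] [Module k Q]

/-- `0 → V → W → Q → 0` is an exact sequence of `G`-modules: `W` is an extension of `V` by `Q`. -/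
structure IsExtension {ρ : Representation k G V} {σ : Representation k G W}
    {τ : Representation k G Q} (ι : ρ.IntertwiningMap σ) (π : σ.IntertwiningMap τ) : Prop where
  injective : Function.Injective ι
  exact : Function.Exact ι π
  surjective : Function.Surjective π

/-- The surjection `π : W → Q` of `G`-modules splits over the subgroup `L`: it has a section that
is a homomorphism of `L`-modules. -/
def SplitsOver {σ : Representation k G W} {τ : Representation k G Q}
    (π : σ.IntertwiningMap τ) (L : Subgroup G) : Prop :=
  ∃ s : Representation.IntertwiningMap (τ.comp L.subtype) (σ.comp L.subtype),
    ∀ q : Q, π (s q) = q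

/-- The surjection `π : W → Q` of `G`-modules is locally split with respect to `𝓛`. -/
def LocallySplit {σ : Representation k G W} {τ : Representation k G Q}
    (π : σ.IntertwiningMap τ) (𝓛 : Set (Subgroup G)) : Prop :=
  ∀ L ∈ 𝓛, SplitsOver π L

/-- The fixed space `C_W(G)`. -/
noncomputable abbrev fixedSpace (σ : Representation k G W) : Submodule k W := σ.invariants

/-- The commutator space `[V, G]`, spanned by the vectors `g v - v`. -/
abbrev commutatorSpace (ρ : Representation k G V) : Submodule k V :=
  Representation.Coinvariants.ker ρ

theorem fixedSpace_le_comap (σ : Representation k G W) (g : G) :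
    fixedSpace σ ≤ (fixedSpace σ).comap (σ g) := by
  intro w hw
  rw [Submodule.mem_comap, hw g]
  exact hw

theorem commutatorSpace_le_comap (ρ : Representation k G V) (g : G) :
    commutatorSpace ρ ≤ (commutatorSpace ρ).comap (ρ g) := by
  intro v hv
  rw [Submodule.mem_comap]
  have h := Submodule.add_mem _ (Representation.Coinvariants.sub_mem_ker (ρ := ρ) g v) hv
  rwa [sub_add_cancel] at h

/-- The `G`-module `W / C_W(G)`. -/
noncomputable abbrev modFixedSpace (σ : Representation k G W) : Representation k G (W ⧸ fixedSpace σ) :=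
  σ.quotient (fixedSpace σ) (fixedSpace_le_comap σ)

/-- The `G`-module `[V, G]`. -/
noncomputable abbrev commutatorRep (ρ : Representation k G V) : Representation k G (commutatorSpace ρ) :=
  ρ.subrepresentation (commutatorSpace ρ) (commutatorSpace_le_comap ρ)

/-- The `G`-homomorphism `φ : W → V^∨∨` extends, along `ι : V → W`, the canonical embedding of `V` in its
double dual. -/
def ExtendsEval {ρ : Representation k G V} {σ : Representation k G W}
    (ι : ρ.IntertwiningMap σ) (φ : σ.IntertwiningMap ρ.dual.dual) : Prop :=
  ∀ v : V, φ (ι v) = Module.Dual.eval k V v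

end

end LocalCohomology

open LocalCohomology

namespace LocalCohomology

/-! Since `G` acts trivially on `Q`, each `w` gives a cocycle `g ↦ g w - w` in `V`, and `φ w` must
satisfy `φ w (g l - l) = l (g⁻¹ w - w)`. This prescription on `[V^∨, G]` is consistent: a linear
relation among the `g l - l` involves finitely many `g`, all in one `L ∈ 𝓛`, where the cocycle is
the coboundary of some `v : V` and the prescription is evaluation at `v`
(`exists_bidual_of_finitely_coboundary`). A functional on `[V^∨, G]` extends to `V^∨`, which gives
(1). The forced values (`ExtendsEval.apply_sub`) give (2): they do not depend on `φ`, and they all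
vanish exactly when `w` is fixed. -/

/-- A finite set of elements lies in a single member of a local system. -/
theorem IsLocalSystem.exists_finset_subset {G : Type*} [Group G] {𝓛 : Set (Subgroup G)}
    (h𝓛 : IsLocalSystem 𝓛) (t : Finset G) : ∃ L ∈ 𝓛, ∀ g ∈ t, g ∈ L := by
  classical
  induction t using Finset.induction_on with
  | empty =>
    obtain ⟨L, hL, -⟩ := h𝓛.exists_mem 1
    exact ⟨L, hL, by simp⟩
  | insert a t _ ih =>
    obtain ⟨L₁, hL₁, h₁⟩ := ih
    obtain ⟨L₂, hL₂, h₂⟩ := h𝓛.exists_mem a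
    obtain ⟨L, hL, hle₁, hle₂⟩ := h𝓛.directed L₁ hL₁ L₂ hL₂
    refine ⟨L, hL, fun g hg => ?_⟩
    rcases Finset.mem_insert.1 hg with rfl | hg
    · exact hle₂ h₂
    · exact hle₁ (h₁ g hg)

section

variable {k G V W Q : Type*} [Field k] [Group G] [AddCommGroup V] [Module k V]
  [AddCommGroup W] [Module k W] [AddCommGroup Q] [Module k Q]

/-- If an extension by a trivial module splits over `L`, then every vector is congruent modulo `V`
to a vector fixed by `L`. -/
theorem SplitsOver.exists_sub_fixed {ρ : Representation k G V} {σ : Representation k G W}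
    {τ : Representation k G Q} (hτ : τ.IsTrivial) {ι : ρ.IntertwiningMap σ}
    {π : σ.IntertwiningMap τ} (hext : IsExtension ι π) {L : Subgroup G} (hL : SplitsOver π L)
    (w : W) : ∃ v : V, ∀ g ∈ L, σ g (w - ι v) = w - ι v := by
  obtain ⟨s, hs⟩ := hL
  obtain ⟨v, hv⟩ := (hext.exact (w - s (π w))).1 (by rw [map_sub, hs, sub_self])
  refine ⟨v, fun g hg => ?_⟩
  have h := s.isIntertwining _ _ (⟨g, hg⟩ : L) (π w)
  have ht : (τ.comp L.subtype) (⟨g, hg⟩ : L) (π w) = π w := congr($(hτ.out g) (π w))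
  rw [ht] at h
  rw [hv, sub_sub_cancel]
  exact h.symm

/-- A family `d : G → V` that on every finite set of elements agrees with some coboundary
`g ↦ g⁻¹ v - v` is the coboundary of a vector of the double dual. -/
theorem exists_bidual_of_finitely_coboundary (ρ : Representation k G V) (d : G → V)
    (hd : ∀ t : Finset G, ∃ v : V, ∀ g ∈ t, d g = ρ g⁻¹ v - v) :
    ∃ f : Module.Dual k (Module.Dual k V),
      ∀ (g : G) (l : Module.Dual k V), f (ρ.dual g l - l) = l (d g) := by
  classical
  let A : (G × Module.Dual k V →₀ k) →ₗ[k] Module.Dual k V :=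
    Finsupp.linearCombination k fun p => ρ.dual p.1 p.2 - p.2
  let B : (G × Module.Dual k V →₀ k) →ₗ[k] k :=
    Finsupp.linearCombination k fun p => p.2 (d p.1)
  -- `f ∘ A = B` is solvable as soon as `B` kills `ker A`, the relations among the `g l - l`.
  have hB : B ∈ LinearMap.range A.dualMap := by
    rw [LinearMap.range_dualMap_eq_dualAnnihilator_ker, Submodule.mem_dualAnnihilator]
    intro x hx
    obtain ⟨v, hv⟩ := hd (x.support.image Prod.fst)
    have hAB : B x = A x v := by
      simp only [A, B, Finsupp.linearCombination_apply, Finsupp.sum, LinearMap.sum_apply]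
      refine Finset.sum_congr rfl fun p hp => ?_
      rw [hv p.1 (Finset.mem_image_of_mem _ hp)]
      simp [Representation.dual_apply, Module.Dual.transpose_apply]
    rw [hAB, LinearMap.mem_ker.1 hx, LinearMap.zero_apply]
  obtain ⟨f, hf⟩ := hB
  refine ⟨f, fun g l => ?_⟩
  have h := congr($hf (Finsupp.single (g, l) 1))
  simpa [A, B] using h

/-- The values on `[V^∨, G]` of an equivariant map to the double dual extending the canonical
embedding. -/
theorem ExtendsEval.apply_sub {ρ : Representation k G V} {σ : Representation k G W}
    {ι : ρ.IntertwiningMap σ} {φ : σ.IntertwiningMap ρ.dual.dual} (hφ : ExtendsEval ι φ)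
    {g : G} {w : W} {v : V} (hv : ι v = σ g⁻¹ w - w) (l : Module.Dual k V) :
    φ w (ρ.dual g l - l) = l v := by
  have h : φ (ι v) l = l v := by rw [hφ v]; rfl
  rw [hv, map_sub, φ.isIntertwining] at h
  simpa [Representation.dual_apply, Module.Dual.transpose_apply] using h

theorem IsExtension.exists_eq_sub {ρ : Representation k G V} {σ : Representation k G W}
    {τ : Representation k G Q} (hτ : τ.IsTrivial) {ι : ρ.IntertwiningMap σ}
    {π : σ.IntertwiningMap τ} (hext : IsExtension ι π) (g : G) (w : W) :
    ∃ v : V, ι v = σ g w - w :=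
  (hext.exact _).1 (by
    rw [map_sub, π.isIntertwining, Representation.isTrivial_apply, sub_self])

/-- A locally split extension by a trivial module is represented in the double dual. -/
theorem exists_extendsEval {𝓛 : Set (Subgroup G)} (h𝓛 : IsLocalSystem 𝓛)
    {ρ : Representation k G V} {σ : Representation k G W} {τ : Representation k G Q}
    (hτ : τ.IsTrivial) {ι : ρ.IntertwiningMap σ} {π : σ.IntertwiningMap τ}
    (hext : IsExtension ι π) (hsplit : LocallySplit π 𝓛) :
    ∃ φ : σ.IntertwiningMap ρ.dual.dual, ExtendsEval ι φ := by
  obtain ⟨r, hr⟩ := ι.toLinearMap.exists_leftInverse_of_injective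
    (LinearMap.ker_eq_bot.2 hext.injective)
  have hrι (v : V) : r (ι v) = v := congr($hr v)
  have hιr (g : G) (w : W) : ι (r (σ g w - w)) = σ g w - w := by
    obtain ⟨v, hv⟩ := hext.exists_eq_sub hτ g w
    rw [← hv, hrι]
  obtain ⟨s, hs⟩ := π.toLinearMap.exists_rightInverse_of_surjective
    (LinearMap.range_eq_top.2 hext.surjective)
  have hπs (q : Q) : π (s q) = q := congr($hs q)
  have key (w : W) : ∃ f : Module.Dual k (Module.Dual k V), ∀ (g : G) (l : Module.Dual k V),
      f (ρ.dual g l - l) = l (r (σ g⁻¹ w - w)) := by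
    refine exists_bidual_of_finitely_coboundary ρ _ fun t => ?_
    obtain ⟨L, hL, htL⟩ := h𝓛.exists_finset_subset t
    obtain ⟨v, hv⟩ := (hsplit L hL).exists_sub_fixed hτ hext w
    refine ⟨v, fun g hg => hext.injective ?_⟩
    have h := hv g⁻¹ (L.inv_mem (htL g hg))
    rw [map_sub, ← ι.isIntertwining, sub_eq_sub_iff_sub_eq_sub] at h
    rw [hιr, map_sub, h]
  choose f hf using key
  -- The chosen `f w` need not be linear in `w`, so only its values at lifts of a basis of `Q` are
  -- kept.
  let b := Module.Basis.ofVectorSpace k Q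
  let F : Q →ₗ[k] Module.Dual k (Module.Dual k V) := b.constr k fun i => f (s (b i))
  have hF (q : Q) (g : G) (l : Module.Dual k V) :
      F q (ρ.dual g l - l) = l (r (σ g⁻¹ (s q) - s q)) := by
    have h : (LinearMap.applyₗ (ρ.dual g l - l)) ∘ₗ F =
        l ∘ₗ r ∘ₗ (σ g⁻¹ - LinearMap.id) ∘ₗ s := by
      refine b.ext fun i => ?_
      simpa [F] using hf (s (b i)) g l
    exact congr($h q)
  -- As a vector space `W = ι V ⊕ s Q`: evaluation on the first summand, `F` on the second.
  let φ : W →ₗ[k] Module.Dual k (Module.Dual k V) :=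
    Module.Dual.eval k V ∘ₗ r ∘ₗ (LinearMap.id - s ∘ₗ π.toLinearMap) + F ∘ₗ π.toLinearMap
  have hφ (w : W) (l : Module.Dual k V) : φ w l = l (r (w - s (π w))) + F (π w) l := rfl
  have hφι (v : V) : φ (ι v) = Module.Dual.eval k V v := by
    have h0 : π (ι v) = 0 := (hext.exact _).2 ⟨v, rfl⟩
    ext l
    rw [hφ, h0]
    simp [hrι]
  have hφsub (w : W) (g : G) (l : Module.Dual k V) :
      φ w (ρ.dual g l - l) = l (r (σ g⁻¹ w - w)) := by
    obtain ⟨v, hv⟩ := (hext.exact (w - s (π w))).1 (by rw [map_sub, hπs, sub_self])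
    have hw : w = ι v + s (π w) := by rw [hv, sub_add_cancel]
    have hrhs : σ g⁻¹ w - w = ι (ρ g⁻¹ v) - ι v + (σ g⁻¹ (s (π w)) - s (π w)) := by
      conv_lhs => rw [hw]
      rw [map_add, ι.isIntertwining]
      abel
    rw [hφ, hF, ← hv, hrι, hrhs, map_add r, map_sub r (ι _), hrι, hrι, map_add]
    simp [Representation.dual_apply, Module.Dual.transpose_apply]
  refine ⟨φ.intertwiningMap_of_isIntertwiningMap _ _ fun g w => ?_, hφι⟩
  ext l
  -- By contragredience, pairing `φ w` with `g⁻¹ l - l` is pairing `g (φ w) - φ w` with `l`.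
  have h := hφsub w g⁻¹ l
  rw [inv_inv] at h
  have h' : φ (σ g w - w) l = l (r (σ g w - w)) := by
    conv_lhs => rw [← hιr g w, hφι]
    rfl
  rw [← h, map_sub, map_sub, LinearMap.sub_apply, sub_left_inj] at h'
  exact h'

end

end LocalCohomology

theorem corollary6 {k G V W Q : Type*} [Field k] [Group G]
    [AddCommGroup V] [Module k V] [AddCommGroup W] [Module k W] [AddCommGroup Q] [Module k Q]
    (𝓛 : Set (Subgroup G)) (h𝓛 : IsLocalSystem 𝓛)
    (ρ : Representation k G V) (σ : Representation k G W) (τ : Representation k G Q)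
    (hτ : τ.IsTrivial)
    (ι : ρ.IntertwiningMap σ) (π : σ.IntertwiningMap τ)
    (hext : IsExtension ι π) (hsplit : LocallySplit π 𝓛) :
    (∃ φ : σ.IntertwiningMap ρ.dual.dual, ExtendsEval ι φ) ∧
    ∃! ψ : (modFixedSpace σ).IntertwiningMap (commutatorRep ρ.dual).dual,
      Function.Injective ψ ∧
      ∀ φ : σ.IntertwiningMap ρ.dual.dual, ExtendsEval ι φ →
        ∀ (w : W) (x : commutatorSpace ρ.dual),
          ψ (Submodule.Quotient.mk w) x = φ w (x : Module.Dual k V) := by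
  obtain ⟨φ, hφ⟩ := exists_extendsEval h𝓛 hτ hext hsplit
  have hagree (φ₁ φ₂ : σ.IntertwiningMap ρ.dual.dual) (h₁ : ExtendsEval ι φ₁)
      (h₂ : ExtendsEval ι φ₂) (w : W) (x : Module.Dual k V) (hx : x ∈ commutatorSpace ρ.dual) :
      φ₁ w x = φ₂ w x := by
    have hle : commutatorSpace ρ.dual ≤ LinearMap.eqLocus (φ₁ w) (φ₂ w) := by
      refine Submodule.span_le.2 ?_
      rintro _ ⟨⟨g, l⟩, rfl⟩
      obtain ⟨v, hv⟩ := hext.exists_eq_sub hτ g⁻¹ w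
      exact (h₁.apply_sub hv l).trans (h₂.apply_sub hv l).symm
    exact hle hx
  let R : W →ₗ[k] Module.Dual k (commutatorSpace ρ.dual) :=
    (commutatorSpace ρ.dual).subtype.dualMap ∘ₗ φ.toLinearMap
  have hR (w : W) (x : commutatorSpace ρ.dual) : R w x = φ w (x : Module.Dual k V) := rfl
  have hker : LinearMap.ker R = fixedSpace σ := by
    ext w
    rw [LinearMap.mem_ker, Representation.mem_invariants]
    constructor
    · intro hw g
      obtain ⟨v, hv⟩ := hext.exists_eq_sub hτ g w
      -- Linear functionals separate the points of `V`.
      have hv0 : v = 0 := by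
        refine (Module.forall_dual_apply_eq_zero_iff k v).1 fun l => ?_
        rw [← hφ.apply_sub (g := g⁻¹) (by rw [inv_inv, hv]) l]
        exact congr($hw ⟨_, Representation.Coinvariants.sub_mem_ker g⁻¹ l⟩)
      rw [hv0, map_zero] at hv
      exact (sub_eq_zero.1 hv.symm)
    · intro hw
      have hle : commutatorSpace ρ.dual ≤ LinearMap.ker (φ w) := by
        refine Submodule.span_le.2 ?_
        rintro _ ⟨⟨g, l⟩, rfl⟩
        have h := hφ.apply_sub (g := g) (w := w) (v := 0) (by rw [hw, map_zero, sub_self]) l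
        rwa [map_zero] at h
      ext x
      exact hle x.2
  let ψ : (modFixedSpace σ).IntertwiningMap (commutatorRep ρ.dual).dual :=
    ((fixedSpace σ).liftQ R hker.ge).intertwiningMap_of_isIntertwiningMap _ _ fun g w => by
      induction w using Submodule.Quotient.induction_on with
      | H w =>
        ext x
        exact DFunLike.congr_fun (φ.isIntertwining _ _ g w) (x : Module.Dual k V)
  refine ⟨⟨φ, hφ⟩, ψ, ⟨?_, fun φ' hφ' w x => hagree φ φ' hφ hφ' w x x.2⟩, ?_⟩
  · exact LinearMap.ker_eq_bot.1 (Submodule.ker_liftQ_eq_bot _ _ _ hker.le)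
  · rintro ψ' ⟨-, hψ'⟩
    refine DFunLike.ext _ _ fun w => ?_
    induction w using Submodule.Quotient.induction_on with
    | H w => exact LinearMap.ext fun x => hψ' φ hφ w x
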